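/- Let $R$ and $S$ be commutative noetherian rings and let $\varphi\colon R\to S$ be a ring homomorphism of finite flat dimension; that is, $S$, viewed as an $R$-module via $\varphi$, admits a resolution of finite length by flat $R$-modules. Assume that for every maximal ideal $\mathfrak m$ of $R$ there is a maximal ideal $\mathfrak n$ of $S$ with $\varphi^{-1}(\mathfrak n)=\mathfrak m$. If $S$ is Tor-persistent, then so is $R$. Here a commutative noetherian ring $A$ is called Tor-persistent if every finitely generated $A$-module $M$ such that $\operatorname{Tor}_i^A(M,M)=0$ for all $i\gg 0$ has finite projective dimension over $A$. -/

import Mathlib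

open CategoryTheory

universe u v

/-- The `R`-module `M` has finite flat dimension: there is an exact sequence of `R`-modules
`0 → F n → ⋯ → F 1 → F 0 → M → 0` with every `F i` flat (written as an infinite resolution
whose terms vanish in degrees greater than `n`). Every module in `Type v` is a quotient of a
free module in `Type (max u v)`, so this universe is large enough for the terms. -/
def HasFiniteFlatDimension (R : Type u) [CommRing R] (M : Type v) [AddCommGroup M]
    [Module R M] : Prop :=
  ∃ (n : ℕ) (F : ℕ → ModuleCat.{max u v} R) (d : ∀ i, F (i + 1) →ₗ[R] F i) (ε : F 0 →ₗ[R] M),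
    (∀ i, Module.Flat R (F i)) ∧
    (∀ i, n < i → Subsingleton (F i)) ∧
    Function.Surjective ε ∧
    Function.Exact (d 0) ε ∧
    ∀ i, Function.Exact (d (i + 1)) (d i)

/-- `R` is Tor-persistent: every finitely generated `R`-module `M` with
`Tor_i^R(M, M) = 0` for all `i ≫ 0` has finite projective dimension.
(In Mathlib `projectiveDimension` takes values in `WithBot ℕ∞`, with value `⊥` at zero modules.) -/
def IsTorPersistent (R : Type u) [CommRing R] : Prop :=
  ∀ M : ModuleCat.{u} R, Module.Finite R M →
    (∃ n : ℕ, ∀ i : ℕ, n ≤ i →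
      Limits.IsZero (((Tor (ModuleCat.{u} R) i).obj M).obj M)) →
    projectiveDimension M < ⊤

/-! Resolve `M` by finite free modules, given by matrices `A i`; the syzygies are the modules `coker
(A i)`. When `A` is exact over `R`, `VanishesAt A X i` says `Tor_{i+1}(coker (A 0), X) = 0`.

If `S` has a flat resolution with at most `t` nonzero terms, `A` stays exact over `S` from index `t`
on. Replace `M` by its syzygy `N = coker (A t)`, whose self-Tor is still bounded
(`VanishesAt.coker_shift`). Now `A ⊗ S` resolves `S ⊗ N` over `S`, so `Tor^S(S ⊗ N, S ⊗ N)` is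
computed by `A ⊗ (S ⊗ N)`; it vanishes in high degrees by dimension shifting along the flat
resolution of `S` (`FlatDimLT.vanishesAt_tensor`).

Tor-persistence of `S` makes some syzygy of `S ⊗ N` projective, so `A` is exact at that spot over
every `S ⧸ q`. Each `R ⧸ m` is a retract of some `S ⧸ q`, and exactness over all `R ⧸ m` makes the
corresponding syzygy of `N` projective (`Matrix.projective_coker`). -/

open TensorProduct

/-! ### Matrices acting on tuples in a module -/

section Act

variable {R : Type*} [CommRing R] {l m n : Type*} [Fintype m] [Fintype n]

/-- A matrix over `R` acts on tuples of elements of an `R`-module `X`; this is the map induced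
by the matrix on `R ^ n ⊗ X`. -/
def Matrix.act (A : Matrix m n R) (X : Type*) [AddCommGroup X] [Module R X] :
    (n → X) →ₗ[R] (m → X) where
  toFun x j := ∑ k, A j k • x k
  map_add' x y := by
    ext j
    simp [smul_add, Finset.sum_add_distrib]
  map_smul' r x := by
    ext j
    simp [Finset.smul_sum, smul_comm r]

variable {X Y : Type*} [AddCommGroup X] [Module R X] [AddCommGroup Y] [Module R Y]

omit [Fintype m] in
theorem Matrix.act_apply (A : Matrix m n R) (x : n → X) (j : m) :
    A.act X x j = ∑ k, A j k • x k := rfl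

omit [Fintype m] in
theorem Matrix.act_comp (A : Matrix m n R) (f : X →ₗ[R] Y) (x : n → X) :
    A.act Y (fun k => f (x k)) = fun j => f (A.act X x j) := by
  ext j
  simp [Matrix.act_apply, map_sum]

theorem Matrix.act_mul (A : Matrix l m R) (B : Matrix m n R) (x : n → X) :
    (A * B).act X x = A.act X (B.act X x) := by
  ext j
  simp only [Matrix.act_apply, Matrix.mul_apply, Finset.smul_sum, Finset.sum_smul, mul_smul]
  exact Finset.sum_comm

omit [Fintype m] in
theorem Matrix.act_add (A B : Matrix m n R) (x : n → X) :
    (A + B).act X x = A.act X x + B.act X x := by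
  ext j
  simp [Matrix.act_apply, add_smul, Finset.sum_add_distrib]

theorem Matrix.act_one [DecidableEq n] (x : n → X) : (1 : Matrix n n R).act X x = x := by
  ext j
  simp [Matrix.act_apply, Matrix.one_apply, ite_smul]

omit [Fintype m] in
theorem Matrix.act_zero (x : n → X) : (0 : Matrix m n R).act X x = 0 := by
  ext j
  simp [Matrix.act_apply]

omit [Fintype m] in
theorem Matrix.act_eq_mulVecLin (A : Matrix m n R) : A.act R = A.mulVecLin := by
  ext x j
  simp [Matrix.act_apply, Matrix.mulVec, dotProduct]

omit [Fintype m] in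
theorem Matrix.act_map {S : Type*} [CommRing S] [Algebra R S] [Module S X] [IsScalarTower R S X]
    (A : Matrix m n R) (x : n → X) : (A.map (algebraMap R S)).act X x = A.act X x := by
  ext j
  simp [Matrix.act_apply]

end Act

/-! ### Exactness with coefficients and long exact sequence arguments -/

section VanishesAt

variable {R : Type*} [CommRing R] {n : ℕ → ℕ}

/-- The complex `⋯ → X ^ n 2 → X ^ n 1 → X ^ n 0` induced by the matrices `A i` is exact
at position `i + 1`. -/
def VanishesAt (A : ∀ i, Matrix (Fin (n i)) (Fin (n (i + 1))) R) (X : Type*) [AddCommGroup X]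
    [Module R X] (i : ℕ) : Prop :=
  Function.Exact ((A (i + 1)).act X) ((A i).act X)

variable {A : ∀ i, Matrix (Fin (n i)) (Fin (n (i + 1))) R}
  {X Y Z : Type*} [AddCommGroup X] [Module R X] [AddCommGroup Y] [Module R Y]
  [AddCommGroup Z] [Module R Z]

theorem VanishesAt.of_retract {i : ℕ} (h : VanishesAt A Y i) (f : X →ₗ[R] Y) (g : Y →ₗ[R] X)
    (hgf : ∀ x, g (f x) = x) : VanishesAt A X i := by
  intro x
  constructor
  · intro hx
    obtain ⟨y, hy⟩ := (h (fun k => f (x k))).1 (by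
      rw [Matrix.act_comp, hx]
      ext
      simp)
    refine ⟨fun k => g (y k), ?_⟩
    rw [Matrix.act_comp, hy]
    ext
    simp [hgf]
  · rintro ⟨y, rfl⟩
    have := (h ((A (i + 1)).act Y fun k => f (y k))).2 ⟨_, rfl⟩
    rw [Matrix.act_comp, Matrix.act_comp] at this
    ext j
    have h2 := congrArg g (congrFun this j)
    simpa [hgf] using h2

theorem VanishesAt.of_linearEquiv {i : ℕ} (h : VanishesAt A Y i) (e : X ≃ₗ[R] Y) :
    VanishesAt A X i :=
  h.of_retract e.toLinearMap e.symm.toLinearMap (by simp)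

theorem VanishesAt.of_subsingleton [Subsingleton X] (i : ℕ) : VanishesAt A X i := by
  intro x
  exact ⟨fun _ => ⟨0, Subsingleton.elim _ _⟩, fun _ => Subsingleton.elim _ _⟩

theorem Matrix.mul_eq_zero_of_vanishesAt {i : ℕ} (h : VanishesAt A R i) :
    A i * A (i + 1) = 0 := by
  have : (A i * A (i + 1)).mulVecLin = 0 := by
    rw [← Matrix.act_eq_mulVecLin]
    refine LinearMap.ext fun x => ?_
    rw [Matrix.act_mul]
    exact (h _).2 ⟨_, rfl⟩
  rw [← Matrix.toLin'_apply'] at this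
  exact Matrix.toLin'.map_eq_zero_iff.1 this

theorem Matrix.act_act_eq_zero {i : ℕ} (hA : A i * A (i + 1) = 0) (x : Fin (n (i + 1 + 1)) → X) :
    (A i).act X ((A (i + 1)).act X x) = 0 := by
  rw [← Matrix.act_mul, hA, Matrix.act_zero]

theorem exists_lift_tuple {f : X →ₗ[R] Y} {g : Y →ₗ[R] Z} (h : Function.Exact f g) {ι : Type*}
    (y : ι → Y) (hy : (fun k => g (y k)) = 0) : ∃ x : ι → X, (fun k => f (x k)) = y := by
  choose x hx using fun k => (h (y k)).1 (congrFun hy k)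
  exact ⟨x, funext hx⟩

/-- The part `H_{i+2}(Y) → H_{i+2}(Z) → H_{i+1}(X)` of the long exact sequence, by a direct chase.
-/
theorem VanishesAt.of_exact_right {f : X →ₗ[R] Y} {g : Y →ₗ[R] Z} (hf : Function.Injective f)
    (hfg : Function.Exact f g) (hg : Function.Surjective g) {i : ℕ}
    (hA : ∀ i, A i * A (i + 1) = 0)
    (hY : VanishesAt A Y (i + 1)) (hX : VanishesAt A X i) : VanishesAt A Z (i + 1) := by
  intro z
  constructor
  · intro hz
    choose y hy using fun k => hg (z k)
    obtain ⟨x, hx⟩ := exists_lift_tuple hfg ((A (i + 1)).act Y y) (by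
      rw [← Matrix.act_comp, ← hz]
      simp [hy])
    obtain ⟨x', rfl⟩ := (hX x).1 (by
      have h1 : (fun j => f ((A i).act X x j)) = 0 := by
        rw [← Matrix.act_comp, hx, Matrix.act_act_eq_zero (hA i)]
      ext j
      exact hf (by simpa using congrFun h1 j))
    obtain ⟨y', hy'⟩ := (hY (y - fun k => f (x' k))).1 (by
      rw [map_sub, Matrix.act_comp, hx, sub_self])
    refine ⟨fun k => g (y' k), ?_⟩
    rw [Matrix.act_comp, hy']
    ext j
    simp [hy, hfg.apply_apply_eq_zero]
  · rintro ⟨z, rfl⟩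
    exact Matrix.act_act_eq_zero (hA _) z

/-- The part `H_{i+2}(Z) → H_{i+1}(X) → H_{i+1}(Y)` of the same sequence. -/
theorem VanishesAt.of_exact_left {f : X →ₗ[R] Y} {g : Y →ₗ[R] Z} (hf : Function.Injective f)
    (hfg : Function.Exact f g) (hg : Function.Surjective g) {i : ℕ}
    (hA : ∀ i, A i * A (i + 1) = 0)
    (hY : VanishesAt A Y i) (hZ : VanishesAt A Z (i + 1)) : VanishesAt A X i := by
  intro x
  constructor
  · intro hx
    obtain ⟨y, hy⟩ := (hY (fun k => f (x k))).1 (by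
      rw [Matrix.act_comp, hx]
      ext
      simp)
    obtain ⟨z, hz⟩ := (hZ (fun k => g (y k))).1 (by
      rw [Matrix.act_comp, hy]
      ext
      simp [hfg.apply_apply_eq_zero])
    choose y' hy' using fun k => hg (z k)
    obtain ⟨x', hx'⟩ := exists_lift_tuple hfg (y - (A (i + 2)).act Y y') (by
      have : (fun k => g ((A (i + 2)).act Y y' k)) = fun k => g (y k) := by
        rw [← Matrix.act_comp, ← hz]
        simp [hy']
      ext k
      simpa [sub_eq_zero] using (congrFun this k).symm)
    refine ⟨x', ?_⟩
    ext j
    apply hf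
    have h1 := Matrix.act_comp (A (i + 1)) f x'
    rw [hx', map_sub, hy, Matrix.act_act_eq_zero (hA _), sub_zero] at h1
    exact (congrFun h1 j).symm
  · rintro ⟨z, rfl⟩
    exact Matrix.act_act_eq_zero (hA _) z

end VanishesAt

/-! ### Tensor products with flat modules and with cokernels -/

section Tensor

variable {R : Type*} [CommRing R] {m n : Type*} [Fintype m] [Fintype n] [DecidableEq m]
  [DecidableEq n] (A : Matrix m n R)
  (F X : Type*) [AddCommGroup F] [Module R F] [AddCommGroup X] [Module R X]

theorem Matrix.piRight_lTensor_act (t : F ⊗[R] (n → X)) :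
    TensorProduct.piRight R R F (fun _ : m => X) ((A.act X).lTensor F t) =
      A.act (F ⊗[R] X) (TensorProduct.piRight R R F (fun _ : n => X) t) := by
  induction t with
  | zero => simp
  | add x y hx hy => simp only [map_add, hx, hy]
  | tmul y x =>
    ext j
    simp [Matrix.act_apply, TensorProduct.tmul_sum]

theorem Matrix.piScalarRight_lTensor_act (t : X ⊗[R] (n → R)) :
    TensorProduct.piScalarRight R R X m ((A.act R).lTensor X t) =
      A.act X (TensorProduct.piScalarRight R R X n t) := by
  induction t with
  | zero => simp
  | add x y hx hy => simp only [map_add, hx, hy]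
  | tmul y x =>
    ext j
    simp [Matrix.act_apply, Finset.sum_smul, mul_smul]

end Tensor

section

variable {R : Type*} [CommRing R] {n : ℕ → ℕ}
  {A : ∀ i, Matrix (Fin (n i)) (Fin (n (i + 1))) R}
  {F X : Type*} [AddCommGroup F] [Module R F] [AddCommGroup X] [Module R X]

theorem VanishesAt.tensor [Module.Flat R F] {i : ℕ} (h : VanishesAt A X i) :
    VanishesAt A (F ⊗[R] X) i := by
  have h1 := Module.Flat.lTensor_exact F h
  intro y
  obtain ⟨t, rfl⟩ := (TensorProduct.piRight R R F (fun _ => X)).surjective y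
  rw [← Matrix.piRight_lTensor_act, LinearEquiv.map_eq_zero_iff, h1 t]
  constructor
  · rintro ⟨s, rfl⟩
    exact ⟨_, (Matrix.piRight_lTensor_act _ _ _ s).symm⟩
  · rintro ⟨y, hy⟩
    obtain ⟨s, rfl⟩ := (TensorProduct.piRight R R F (fun _ => X)).surjective y
    rw [← Matrix.piRight_lTensor_act] at hy
    exact ⟨s, (TensorProduct.piRight R R F _).injective hy⟩

theorem VanishesAt.of_flat [Module.Flat R F] {i : ℕ} (h : VanishesAt A R i) :
    VanishesAt A F i :=
  (h.tensor (F := F)).of_linearEquiv (TensorProduct.rid R F).symm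

/-- The cokernel of the action of a matrix. -/
abbrev Matrix.Coker {R : Type*} [CommRing R] {m n : Type*} [Fintype n] [Fintype m]
    (A : Matrix m n R) (X : Type*) [AddCommGroup X] [Module R X] : Type _ :=
  (m → X) ⧸ LinearMap.range (A.act X)

/-- The projection `X ^ m → X ⊗ coker A`. -/
noncomputable def Matrix.toTensorCoker {R : Type*} [CommRing R] {m n : Type*} [Fintype n]
    [Fintype m] [DecidableEq m] (A : Matrix m n R) (X : Type*) [AddCommGroup X] [Module R X] :
    (m → X) →ₗ[R] X ⊗[R] A.Coker R :=
  ((LinearMap.range (A.act R)).mkQ.lTensor X) ∘ₗ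
    (TensorProduct.piScalarRight R R X m).symm.toLinearMap

section

variable {m n : Type*} [Fintype n] [Fintype m] [DecidableEq m] (A : Matrix m n R)

theorem Matrix.toTensorCoker_surjective : Function.Surjective (A.toTensorCoker X) :=
  (LinearMap.lTensor_surjective X (Submodule.mkQ_surjective _)).comp
    (TensorProduct.piScalarRight R R X m).symm.surjective

theorem Matrix.exact_act_toTensorCoker [DecidableEq n] : Function.Exact (A.act X) (A.toTensorCoker X) := by
  have h := lTensor_exact X (LinearMap.exact_map_mkQ_range (A.act R))
    (Submodule.mkQ_surjective _)
  intro y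
  obtain ⟨t, rfl⟩ := (TensorProduct.piScalarRight R R X m).surjective y
  simp only [Matrix.toTensorCoker, LinearMap.comp_apply, LinearEquiv.coe_coe,
    LinearEquiv.symm_apply_apply]
  rw [h t]
  constructor
  · rintro ⟨s, rfl⟩
    exact ⟨_, (Matrix.piScalarRight_lTensor_act A X s).symm⟩
  · rintro ⟨y, hy⟩
    obtain ⟨s, rfl⟩ := (TensorProduct.piScalarRight R R X n).surjective y
    rw [← Matrix.piScalarRight_lTensor_act] at hy
    exact ⟨s, (TensorProduct.piScalarRight R R X m).injective hy⟩

theorem Matrix.toTensorCoker_comp (f : F →ₗ[R] X) (x : m → F) :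
    A.toTensorCoker X (fun k => f (x k)) = f.rTensor _ (A.toTensorCoker F x) := by
  obtain ⟨t, rfl⟩ := (TensorProduct.piScalarRight R R F m).surjective x
  have : (fun k => f (TensorProduct.piScalarRight R R F m t k)) =
      TensorProduct.piScalarRight R R X m (f.rTensor _ t) := by
    induction t with
    | zero => ext; simp
    | add x y hx hy =>
      simp only [map_add]
      rw [← hx, ← hy]
      ext
      simp
    | tmul y x => ext j; simp
  rw [this]
  simp only [Matrix.toTensorCoker, LinearMap.comp_apply, LinearEquiv.coe_coe,
    LinearEquiv.symm_apply_apply]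
  rw [← LinearMap.comp_apply, ← LinearMap.comp_apply, LinearMap.lTensor_comp_rTensor,
    LinearMap.rTensor_comp_lTensor]

end

variable {Y Z : Type*} [AddCommGroup Y] [Module R Y] [AddCommGroup Z] [Module R Z]

/-- The kernel is the image of the connecting map from `H_1(Z)`, which is zero by `hZ`. -/
theorem rTensor_coker_injective {f : X →ₗ[R] Y} {g : Y →ₗ[R] Z} (hf : Function.Injective f)
    (hfg : Function.Exact f g) (hg : Function.Surjective g) (hA : A 0 * A 1 = 0)
    (hZ : VanishesAt A Z 0) : Function.Injective (f.rTensor ((A 0).Coker R)) := by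
  rw [injective_iff_map_eq_zero]
  intro w hw
  obtain ⟨x, rfl⟩ := (A 0).toTensorCoker_surjective w
  rw [← Matrix.toTensorCoker_comp, (A 0).exact_act_toTensorCoker] at hw
  obtain ⟨y, hy⟩ := hw
  obtain ⟨z, hz⟩ := (hZ (fun k => g (y k))).1 (by
    rw [Matrix.act_comp, hy]
    ext
    simp [hfg.apply_apply_eq_zero])
  choose y' hy' using fun k => hg (z k)
  obtain ⟨x', hx'⟩ := exists_lift_tuple hfg (y - (A 1).act Y y') (by
    have : (fun k => g ((A 1).act Y y' k)) = fun k => g (y k) := by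
      rw [← Matrix.act_comp, ← hz]
      simp [hy']
    ext k
    simpa [sub_eq_zero] using (congrFun this k).symm)
  rw [(A 0).exact_act_toTensorCoker]
  refine ⟨x', ?_⟩
  ext j
  apply hf
  have h1 := Matrix.act_comp (A 0) f x'
  rw [hx', map_sub, hy, Matrix.act_act_eq_zero hA, sub_zero] at h1
  exact (congrFun h1 j).symm

end

/-! ### Dimension shifting along flat resolutions -/

section FlatDim

/-- `X` has a resolution by flat modules with at most `t` nonzero terms. -/
def FlatDimLT (R : Type u) [CommRing R] : ℕ → ModuleCat.{v} R → Prop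
  | 0, X => Subsingleton X
  | t + 1, X => ∃ (F K : ModuleCat.{v} R) (f : K →ₗ[R] F) (g : F →ₗ[R] X),
      Module.Flat R F ∧ Function.Injective f ∧ Function.Exact f g ∧ Function.Surjective g ∧
        FlatDimLT R t K

variable {R : Type u} [CommRing R] {n : ℕ → ℕ}
  {A : ∀ i, Matrix (Fin (n i)) (Fin (n (i + 1))) R}

theorem flatDimLT_of_resolution (t : ℕ) : ∀ (F : ℕ → ModuleCat.{v} R)
    (d : ∀ i, F (i + 1) →ₗ[R] F i) (X : ModuleCat.{v} R) (ε : F 0 →ₗ[R] X),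
    (∀ i, Module.Flat R (F i)) → (∀ i, t ≤ i → Subsingleton (F i)) →
    Function.Surjective ε → Function.Exact (d 0) ε →
    (∀ i, Function.Exact (d (i + 1)) (d i)) → FlatDimLT R t X := by
  induction t with
  | zero =>
    intro F d X ε _ h0 hε _ _
    have := h0 0 le_rfl
    exact hε.subsingleton
  | succ t ih =>
    intro F d X ε hF h0 hε hdε hd
    refine ⟨F 0, ModuleCat.of R (LinearMap.ker ε), (LinearMap.ker ε).subtype, ε, hF 0,
      Subtype.val_injective, LinearMap.exact_subtype_ker_map ε, hε, ?_⟩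
    refine ih (fun i => F (i + 1)) (fun i => d (i + 1)) _
      ((d 0).codRestrict (LinearMap.ker ε) fun x => hdε.apply_apply_eq_zero x)
      (fun i => hF _) (fun i hi => h0 _ (by omega)) ?_ ?_ fun i => hd _
    · rintro ⟨x, hx⟩
      obtain ⟨y, rfl⟩ := (hdε x).1 hx
      exact ⟨y, rfl⟩
    · intro y
      rw [← hd 0 y]
      exact Subtype.ext_iff

theorem FlatDimLT.vanishesAt (hA : ∀ i, VanishesAt A R i) {t : ℕ} :
    ∀ {X : ModuleCat.{v} R}, FlatDimLT R t X → ∀ i, t ≤ i → VanishesAt A X i := by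
  have hA' i := Matrix.mul_eq_zero_of_vanishesAt (hA i)
  induction t with
  | zero =>
    intro X hX i _
    have : Subsingleton X := hX
    exact .of_subsingleton i
  | succ t ih =>
    rintro X ⟨F, K, f, g, hF, hf, hfg, hg, hK⟩ i hi
    obtain ⟨i, rfl⟩ : ∃ j, i = j + 1 := ⟨i - 1, by omega⟩
    exact .of_exact_right hf hfg hg hA' (hA _).of_flat (ih hK i (by omega))

/-- Tor-vanishing of `X` against `coker (A 0)` passes to the kernel `K`, so the flat resolution
stays exact after tensoring with `coker (A 0)`; each step costs one degree. -/
theorem FlatDimLT.vanishesAt_tensor (hA : ∀ i, VanishesAt A R i) {i₀ : ℕ}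
    (hN : ∀ i, i₀ ≤ i → VanishesAt A ((A 0).Coker R) i) {t : ℕ} :
    ∀ {X : ModuleCat.{v} R}, FlatDimLT R t X → (∀ i, VanishesAt A X i) →
      ∀ i, i₀ + t ≤ i → VanishesAt A (X ⊗[R] (A 0).Coker R) i := by
  have hA' i := Matrix.mul_eq_zero_of_vanishesAt (hA i)
  induction t with
  | zero =>
    intro X hX _ i _
    have : Subsingleton X := hX
    have : Subsingleton (X ⊗[R] (A 0).Coker R) := inferInstance
    exact .of_subsingleton i
  | succ t ih =>
    rintro X ⟨F, K, f, g, hF, hf, hfg, hg, hK⟩ hX i hi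
    obtain ⟨i, rfl⟩ : ∃ j, i = j + 1 := ⟨i - 1, by omega⟩
    exact .of_exact_right (rTensor_coker_injective hf hfg hg (hA' 0) (hX 0))
      (rTensor_exact _ hfg hg) (LinearMap.rTensor_surjective _ hg) hA'
      (hN _ (by omega)).tensor
      (ih hK (fun j => .of_exact_left hf hfg hg hA' (hA j).of_flat (hX _)) i (by omega))

end FlatDim

/-! ### Syzygies and the local criterion for projectivity -/

section CokerMap

variable {R : Type*} [CommRing R] {n : ℕ → ℕ}
  {A : ∀ i, Matrix (Fin (n i)) (Fin (n (i + 1))) R}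

/-- The map `coker (A (i + 1)) → R ^ n i` induced by `A i`. -/
def Matrix.cokerMap {i : ℕ} (hA : A i * A (i + 1) = 0) :
    (A (i + 1)).Coker R →ₗ[R] (Fin (n i) → R) :=
  (LinearMap.range ((A (i + 1)).act R)).liftQ ((A i).act R) (by
    rintro _ ⟨x, rfl⟩
    exact Matrix.act_act_eq_zero hA x)

variable {i : ℕ} (hA : A i * A (i + 1) = 0)

theorem Matrix.exact_cokerMap_mkQ :
    Function.Exact (Matrix.cokerMap hA) (LinearMap.range ((A i).act R)).mkQ := by
  rw [LinearMap.exact_iff, Submodule.ker_mkQ, Matrix.cokerMap, Submodule.range_liftQ]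

theorem Matrix.cokerMap_injective (h : VanishesAt A R i) :
    Function.Injective (Matrix.cokerMap hA) := by
  rw [← LinearMap.ker_eq_bot, Matrix.cokerMap, Submodule.ker_liftQ_eq_bot']
  exact (LinearMap.exact_iff.1 h).symm

/-- The kernel of this map is the homology at position `i + 1`. -/
theorem Matrix.lTensor_cokerMap_injective {X : Type*} [AddCommGroup X] [Module R X]
    (h : VanishesAt A X i) : Function.Injective ((Matrix.cokerMap hA).lTensor X) := by
  rw [injective_iff_map_eq_zero]
  intro w hw
  obtain ⟨x, rfl⟩ := (A (i + 1)).toTensorCoker_surjective w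
  rw [(A (i + 1)).exact_act_toTensorCoker, ← h x]
  obtain ⟨t, rfl⟩ := (TensorProduct.piScalarRight R R X _).surjective x
  simp only [Matrix.toTensorCoker, LinearMap.comp_apply, LinearEquiv.coe_coe,
    LinearEquiv.symm_apply_apply] at hw
  rw [← Matrix.piScalarRight_lTensor_act]
  have : (Matrix.cokerMap hA) ∘ₗ (LinearMap.range ((A (i + 1)).act R)).mkQ = (A i).act R :=
    Submodule.liftQ_mkQ _ _ _
  rw [← this, LinearMap.lTensor_comp, LinearMap.comp_apply, hw, map_zero]

end CokerMap

section LocalCriterion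

variable {R : Type*} [CommRing R]

/-- The cokernel of a matrix commutes with base change. -/
noncomputable def Matrix.baseChangeCokerEquiv {m n : Type*} [Fintype m] [Fintype n] [DecidableEq m]
    [DecidableEq n] (A : Matrix m n R) (S : Type*) [CommRing S] [Algebra R S] :
    (A.map (algebraMap R S)).Coker S ≃ₗ[R] S ⊗[R] A.Coker R :=
  (Submodule.Quotient.restrictScalarsEquiv R _).symm ≪≫ₗ
    Submodule.quotEquivOfEq _ _ (by
      ext x
      rw [LinearMap.mem_ker, A.exact_act_toTensorCoker (X := S) x]
      simp only [Submodule.restrictScalars_mem, LinearMap.mem_range, Set.mem_range,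
        Matrix.act_map]) ≪≫ₗ
    (A.toTensorCoker S).quotKerEquivOfSurjective A.toTensorCoker_surjective

variable {n : ℕ → ℕ} {A : ∀ i, Matrix (Fin (n i)) (Fin (n (i + 1))) R} {i : ℕ}

theorem Matrix.free_coker_of_isLocalRing [IsLocalRing R] (hA : A i * A (i + 1) = 0)
    (h : VanishesAt A (IsLocalRing.ResidueField R) i) : Module.Free R ((A i).Coker R) :=
  Module.free_of_lTensor_residueField_injective (Matrix.cokerMap hA)
    (LinearMap.range ((A i).act R)).mkQ (Submodule.mkQ_surjective _)
    (Matrix.exact_cokerMap_mkQ hA) (Matrix.lTensor_cokerMap_injective hA h)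

theorem VanishesAt.map {S X : Type*} [CommRing S] [Algebra R S] [AddCommGroup X] [Module R X]
    [Module S X] [IsScalarTower R S X] (h : VanishesAt A X i) :
    VanishesAt (fun j => (A j).map (algebraMap R S)) X i := by
  intro x
  simpa only [Matrix.act_map, Set.mem_range] using h x

theorem VanishesAt.of_map {S X : Type*} [CommRing S] [Algebra R S] [AddCommGroup X] [Module R X]
    [Module S X] [IsScalarTower R S X]
    (h : VanishesAt (fun j => (A j).map (algebraMap R S)) X i) : VanishesAt A X i := by
  intro x
  simpa only [Matrix.act_map, Set.mem_range] using h x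

/-- Flatness is checked at each maximal ideal, where `R ⧸ m` is the residue field of the
localization and the local criterion applies; flat and finitely presented gives projective. -/
theorem Matrix.projective_coker [IsNoetherianRing R] (hA : A i * A (i + 1) = 0)
    (h : ∀ m : Ideal R, m.IsMaximal → VanishesAt A (R ⧸ m) i) :
    Module.Projective R ((A i).Coker R) := by
  have : Module.Flat R ((A i).Coker R) := by
    refine Module.flat_of_isLocalized_maximal R ((A i).Coker R)
      (fun P _ => Localization.AtPrime P ⊗[R] (A i).Coker R)
      (fun P _ => TensorProduct.mk R (Localization.AtPrime P) _ 1) fun P hP => ?_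
    have h1 : VanishesAt A P.ResidueField i := (h P hP).of_linearEquiv
      (LinearEquiv.ofBijective (Algebra.linearMap (R ⧸ P) P.ResidueField |>.restrictScalars R)
        P.bijective_algebraMap_quotient_residueField).symm
    have h2 : Module.Free (Localization.AtPrime P)
        (((A i).map (algebraMap R (Localization.AtPrime P))).Coker (Localization.AtPrime P)) :=
      Matrix.free_coker_of_isLocalRing
        (A := fun j => (A j).map (algebraMap R (Localization.AtPrime P)))
        (by rw [← Matrix.map_mul, hA]; simp) h1.map
    have h3 := Module.Flat.trans R (Localization.AtPrime P)
      (((A i).map (algebraMap R (Localization.AtPrime P))).Coker (Localization.AtPrime P))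
    exact .of_linearEquiv ((A i).baseChangeCokerEquiv _).symm
  have : Module.FinitePresentation R ((A i).Coker R) :=
    Module.finitePresentation_of_finite R _
  exact Module.Flat.projective_of_finitePresentation

/-- The field `R ⧸ m` embeds in `S ⧸ q`, and the embedding splits as a map of vector spaces. -/
theorem VanishesAt.quotient_of_comap_eq {S : Type*} [CommRing S] [Algebra R S] {m : Ideal R}
    {q : Ideal S} [m.IsMaximal] (hq : q.comap (algebraMap R S) = m)
    (h : VanishesAt A (S ⧸ q) i) : VanishesAt A (R ⧸ m) i := by
  let := Ideal.Quotient.field m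
  let : Algebra (R ⧸ m) (S ⧸ q) := (Ideal.quotientMap q (algebraMap R S) hq.ge).toAlgebra
  have : IsScalarTower R (R ⧸ m) (S ⧸ q) := .of_algebraMap_eq fun x => rfl
  have hinj : Function.Injective (algebraMap (R ⧸ m) (S ⧸ q)) :=
    Ideal.quotientMap_injective' hq.le
  obtain ⟨g, hg⟩ := (Algebra.linearMap (R ⧸ m) (S ⧸ q)).exists_leftInverse_of_injective
    (LinearMap.ker_eq_bot.2 hinj)
  exact h.of_retract ((Algebra.linearMap (R ⧸ m) (S ⧸ q)).restrictScalars R)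
    (g.restrictScalars R) fun x => LinearMap.congr_fun hg x

end LocalCriterion

/-! ### Projective syzygies and projective dimension -/

section Projective

variable {R : Type*} [CommRing R]

theorem LinearMap.exists_comp_eq_of_range_le {P M N : Type*} [AddCommGroup P] [Module R P]
    [AddCommGroup M] [Module R M] [AddCommGroup N] [Module R N] [Module.Projective R P]
    (f : P →ₗ[R] N) (g : M →ₗ[R] N) (h : ∀ x, f x ∈ LinearMap.range g) :
    ∃ k : P →ₗ[R] M, g ∘ₗ k = f := by
  obtain ⟨k, hk⟩ := Module.projective_lifting_property g.rangeRestrict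
    (f.codRestrict (LinearMap.range g) h) g.surjective_rangeRestrict
  exact ⟨k, LinearMap.ext fun x => congrArg Subtype.val (LinearMap.congr_fun hk x)⟩

variable {n : ℕ → ℕ} {A : ∀ i, Matrix (Fin (n i)) (Fin (n (i + 1))) R} {i : ℕ}

/-- A projective cokernel splits the complex at this spot. The contraction is an identity of
matrices, so it acts on every `X`. -/
theorem VanishesAt.of_projective_coker (h : VanishesAt A R i)
    [Module.Projective R ((A i).Coker R)] {X : Type*} [AddCommGroup X] [Module R X] :
    VanishesAt A X i := by
  obtain ⟨σ, hσ⟩ := Module.projective_lifting_property (LinearMap.range ((A i).act R)).mkQ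
    LinearMap.id (Submodule.mkQ_surjective _)
  -- With `π` the projection to the cokernel, `b` solves `A i ∘ b = id - σ ∘ π`, and `c` below
  -- solves `A (i + 1) ∘ c = id - b ∘ A i`.
  obtain ⟨b, hb⟩ := LinearMap.exists_comp_eq_of_range_le
    (LinearMap.id - σ ∘ₗ (LinearMap.range ((A i).act R)).mkQ) ((A i).act R) (by
      intro x
      rw [← Submodule.Quotient.mk_eq_zero, ← Submodule.mkQ_apply]
      have := LinearMap.congr_fun hσ ((LinearMap.range ((A i).act R)).mkQ x)
      simp only [LinearMap.comp_apply, LinearMap.id_apply] at this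
      rw [LinearMap.sub_apply, map_sub, LinearMap.comp_apply, this, LinearMap.id_apply, sub_self])
  obtain ⟨c, hc⟩ := LinearMap.exists_comp_eq_of_range_le
    (LinearMap.id - b ∘ₗ (A i).act R) ((A (i + 1)).act R) (by
      intro x
      refine (h _).1 ?_
      have := LinearMap.congr_fun hb ((A i).act R x)
      have h0 : (LinearMap.range ((A i).act R)).mkQ ((A i).act R x) = 0 := by simp
      simp only [LinearMap.comp_apply, LinearMap.sub_apply, LinearMap.id_apply, h0, map_zero,
        sub_zero] at this
      simp [this])
  obtain ⟨B, rfl⟩ := Matrix.toLin'.surjective b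
  obtain ⟨C, rfl⟩ := Matrix.toLin'.surjective c
  have key : 1 = B * A i + A (i + 1) * C := by
    apply Matrix.toLin'.injective
    rw [map_add, Matrix.toLin'_mul, Matrix.toLin'_mul, Matrix.toLin'_one]
    rw [Matrix.act_eq_mulVecLin, Matrix.act_eq_mulVecLin, ← Matrix.toLin'_apply',
      ← Matrix.toLin'_apply'] at hc
    rw [hc]
    abel
  intro x
  constructor
  · intro hx
    refine ⟨C.act X x, ?_⟩
    have := Matrix.act_one (R := R) x
    rw [key, Matrix.act_add, Matrix.act_mul, hx, map_zero, zero_add, Matrix.act_mul] at this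
    exact this
  · rintro ⟨y, rfl⟩
    exact Matrix.act_act_eq_zero (Matrix.mul_eq_zero_of_vanishesAt h) y

end Projective

section ProjectiveDimension

variable {R : Type u} [CommRing R] {n : ℕ → ℕ}
  {A : ∀ i, Matrix (Fin (n i)) (Fin (n (i + 1))) R}

theorem hasProjectiveDimensionLT_coker_iff (hA : ∀ i, VanishesAt A R i) (t : ℕ) (i : ℕ) :
    HasProjectiveDimensionLT (ModuleCat.of R ((A i).Coker R)) (t + 1) ↔
      Module.Projective R ((A (i + t)).Coker R) := by
  induction t generalizing i with
  | zero =>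
    rw [← projective_iff_hasProjectiveDimensionLT_one, ← IsProjective.iff_projective]
    rfl
  | succ t ih =>
    have h0 := Matrix.mul_eq_zero_of_vanishesAt (hA i)
    have hS := ModuleCat.shortComplex_shortExact
      (ModuleCat.shortComplexOfCompEqZero (Matrix.cokerMap h0)
        (LinearMap.range ((A i).act R)).mkQ (Matrix.exact_cokerMap_mkQ h0).linearMap_comp_eq_zero)
      (Matrix.exact_cokerMap_mkQ h0) (Matrix.cokerMap_injective h0 (hA i))
      (Submodule.mkQ_surjective _)
    refine (hS.hasProjectiveDimensionLT_X₃_iff t ?_).trans ?_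
    · exact ModuleCat.projective_of_categoryTheory_projective _
    · refine (ih (i + 1)).trans ?_
      rw [show i + 1 + t = i + (t + 1) by ring]

theorem projectiveDimension_coker_lt_top_iff (hA : ∀ i, VanishesAt A R i) (i : ℕ) :
    projectiveDimension (ModuleCat.of R ((A i).Coker R)) < ⊤ ↔
      ∃ t, Module.Projective R ((A (i + t)).Coker R) := by
  rw [lt_top_iff_ne_top, projectiveDimension_ne_top_iff]
  exact exists_congr fun t => hasProjectiveDimensionLT_coker_iff hA t i

end ProjectiveDimension

/-! ### Finite free resolutions and the computation of Tor -/

section Resolution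

theorem Submodule.exists_matrix_range_act {R : Type*} [CommRing R] [IsNoetherianRing R] {m : ℕ}
    (K : Submodule R (Fin m → R)) :
    ∃ (n : ℕ) (B : Matrix (Fin m) (Fin n) R), LinearMap.range (B.act R) = K := by
  obtain ⟨n, f, hf⟩ := Module.Finite.exists_fin' R K
  refine ⟨n, LinearMap.toMatrix' (K.subtype ∘ₗ f), ?_⟩
  rw [Matrix.act_eq_mulVecLin, ← Matrix.toLin'_apply', Matrix.toLin'_toMatrix',
    LinearMap.range_comp, LinearMap.range_eq_top.2 hf, Submodule.map_top, Submodule.range_subtype]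

theorem exists_matrix_resolution (R : Type*) [CommRing R] [IsNoetherianRing R] (M : Type*)
    [AddCommGroup M] [Module R M] [Module.Finite R M] :
    ∃ (n : ℕ → ℕ) (A : ∀ i, Matrix (Fin (n i)) (Fin (n (i + 1))) R)
      (ε : (Fin (n 0) → R) →ₗ[R] M), Function.Surjective ε ∧ Function.Exact ((A 0).act R) ε ∧
        ∀ i, VanishesAt A R i := by
  obtain ⟨m, ε, hε⟩ := Module.Finite.exists_fin' R M
  choose rank mat hmat using fun (s : Σ m : ℕ, Submodule R (Fin m → R)) =>
    s.2.exists_matrix_range_act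
  -- The state is a free module with the submodule that the next matrix must have as range.
  let s : ℕ → Σ m : ℕ, Submodule R (Fin m → R) := fun i =>
    Nat.rec ⟨m, LinearMap.ker ε⟩ (fun _ s => ⟨rank s, LinearMap.ker ((mat s).act R)⟩) i
  refine ⟨fun i => (s i).1, fun i => mat (s i), ε, hε, ?_, fun i => ?_⟩
  · exact LinearMap.exact_iff.2 (hmat (s 0)).symm
  · exact LinearMap.exact_iff.2 (hmat (s (i + 1))).symm

end Resolution

section Tor

variable {R : Type u} [CommRing R] {n : ℕ → ℕ}
  {A : ∀ i, Matrix (Fin (n i)) (Fin (n (i + 1))) R}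

/-- The complex of free modules given by a sequence of matrices. -/
noncomputable def matrixComplex (hA : ∀ i, A i * A (i + 1) = 0) :
    ChainComplex (ModuleCat.{u} R) ℕ :=
  ChainComplex.of (fun i => ModuleCat.of R (Fin (n i) → R)) (fun i => ModuleCat.ofHom ((A i).act R))
    fun i => by
      ext1
      exact LinearMap.ext fun x => Matrix.act_act_eq_zero (hA i) x

theorem matrixComplex_d (hA : ∀ i, A i * A (i + 1) = 0) (i : ℕ) :
    (matrixComplex hA).d (i + 1) i = ModuleCat.ofHom ((A i).act R) := by
  simp [matrixComplex]

/-- A sequence of matrices exact over `R` gives a projective resolution. -/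
noncomputable def matrixResolution (hA : ∀ i, VanishesAt A R i) {M : ModuleCat.{u} R}
    (ε : (Fin (n 0) → R) →ₗ[R] M) (hε : Function.Surjective ε)
    (hex : Function.Exact ((A 0).act R) ε) : ProjectiveResolution M where
  complex := matrixComplex fun i => Matrix.mul_eq_zero_of_vanishesAt (hA i)
  projective i := (ModuleCat.of R (Fin (n i) → R)).projective_of_categoryTheory_projective
  π := (ChainComplex.toSingle₀Equiv _ _).symm ⟨ModuleCat.ofHom ε, by
    rw [matrixComplex_d]
    ext1
    exact hex.linearMap_comp_eq_zero⟩
  quasiIso := ⟨fun i => by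
    cases i
    · rw [ChainComplex.quasiIsoAt₀_iff, ShortComplex.quasiIso_iff_of_zeros']
      · have hS : (ShortComplex.mk (ModuleCat.ofHom ((A 0).act R)) (ModuleCat.ofHom ε)
            (by ext1; exact hex.linearMap_comp_eq_zero)).Exact :=
          (ShortComplex.ShortExact.moduleCat_exact_iff_function_exact _).2 hex
        refine (ShortComplex.exact_and_epi_g_iff_of_iso ?_).2
          ⟨hS, (ModuleCat.epi_iff_surjective _).2 hε⟩
        exact ShortComplex.isoMk (Iso.refl _) (Iso.refl _) (Iso.refl _)
          ((Category.id_comp _).trans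
            ((matrixComplex_d (fun i => Matrix.mul_eq_zero_of_vanishesAt (hA i)) 0).symm.trans (Category.comp_id _).symm))
          (by
            refine (Category.id_comp _).trans (Eq.trans ?_ (Category.comp_id _).symm)
            exact (ChainComplex.toSingle₀Equiv_symm_apply_f_zero (C := matrixComplex _) _ _).symm)
      all_goals rfl
    · rename_i i
      rw [quasiIsoAt_iff_exactAt']
      · rw [HomologicalComplex.exactAt_iff' _ (i + 1 + 1) (i + 1) i (by simp) (by simp),
          ShortComplex.ShortExact.moduleCat_exact_iff_function_exact]
        dsimp [HomologicalComplex.sc', HomologicalComplex.shortComplexFunctor']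
        rw [matrixComplex_d, matrixComplex_d]
        exact hA i
      · apply ChainComplex.exactAt_succ_single_obj⟩

theorem isZero_Tor_iff_vanishesAt (hA : ∀ i, VanishesAt A R i) {M : ModuleCat.{u} R}
    (ε : (Fin (n 0) → R) →ₗ[R] M) (hε : Function.Surjective ε)
    (hex : Function.Exact ((A 0).act R) ε) (Y : ModuleCat.{u} R) (i : ℕ) :
    Limits.IsZero (((Tor (ModuleCat.{u} R) (i + 1)).obj Y).obj M) ↔ VanishesAt A Y i := by
  refine (((matrixResolution hA ε hε hex).isoLeftDerivedObj
    ((MonoidalCategory.tensoringLeft (ModuleCat.{u} R)).obj Y) (i + 1)).isZero_iff).trans ?_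
  refine (HomologicalComplex.exactAt_iff_isZero_homology _ _).symm.trans ?_
  rw [HomologicalComplex.exactAt_iff' _ (i + 1 + 1) (i + 1) i (by simp) (by simp),
    ShortComplex.ShortExact.moduleCat_exact_iff_function_exact]
  have hA' i := Matrix.mul_eq_zero_of_vanishesAt (hA i)
  change Function.Exact (((matrixComplex hA').d (i + 1 + 1) (i + 1)).hom.lTensor Y)
    (((matrixComplex hA').d (i + 1) i).hom.lTensor Y) ↔ _
  rw [matrixComplex_d, matrixComplex_d]
  change Function.Exact (((A (i + 1)).act R).lTensor Y) (((A i).act R).lTensor Y) ↔ _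
  refine (Function.Exact.iff_of_ladder_linearEquiv
    (e₁ := TensorProduct.piScalarRight R R Y _) (e₂ := TensorProduct.piScalarRight R R Y _)
    (e₃ := TensorProduct.piScalarRight R R Y _) ?_ ?_).symm
  · exact LinearMap.ext fun t => (Matrix.piScalarRight_lTensor_act _ Y t).symm
  · exact LinearMap.ext fun t => (Matrix.piScalarRight_lTensor_act _ Y t).symm

end Tor

/-! ### Truncation and descent from `S` to `R` -/

section Main

variable {R : Type u} [CommRing R] {n : ℕ → ℕ}
  {A : ∀ i, Matrix (Fin (n i)) (Fin (n (i + 1))) R}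

/-- Consecutive syzygies are the ends of a short exact sequence with free middle term. -/
theorem VanishesAt.coker_shift (hA : ∀ i, VanishesAt A R i) {i₀ : ℕ}
    (h : ∀ i, i₀ ≤ i → VanishesAt A ((A 0).Coker R) i) (t : ℕ) :
    ∀ i, i₀ ≤ i → VanishesAt A ((A t).Coker R) i := by
  have hA' i := Matrix.mul_eq_zero_of_vanishesAt (hA i)
  induction t with
  | zero => exact h
  | succ t ih =>
    intro i hi
    exact .of_exact_left (Matrix.cokerMap_injective (hA' t) (hA t))
      (Matrix.exact_cokerMap_mkQ (hA' t)) (Submodule.mkQ_surjective _) hA'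
      (hA i).of_flat (ih (i + 1) (by omega))

theorem VanishesAt.shift {X : Type*} [AddCommGroup X] [Module R X] {i t : ℕ}
    (h : VanishesAt A X (t + i)) :
    VanishesAt (n := fun i => n (t + i)) (fun i => A (t + i)) X i := h

theorem HasFiniteFlatDimension.exists_flatDimLT {S : Type v} [AddCommGroup S] [Module R S]
    (h : HasFiniteFlatDimension R S) :
    ∃ t, FlatDimLT R t (ModuleCat.of R (ULift.{max u v} S)) := by
  obtain ⟨t, F, d, ε, hF, h0, hε, hdε, hd⟩ := h
  refine ⟨t + 1, flatDimLT_of_resolution (t + 1) F d _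
    ((ULift.moduleEquiv (R := R) (M := S)).symm.toLinearMap ∘ₗ ε) hF (fun i hi => h0 i hi)
    (ULift.moduleEquiv.symm.surjective.comp hε) ?_ hd⟩
  intro x
  rw [← hdε x]
  exact LinearEquiv.map_eq_zero_iff (ULift.moduleEquiv (R := R) (M := S)).symm

/-- If the finite free resolution `A` stays exact over `S`, and the self-`Tor` of `coker (A 0)`
is bounded, then finiteness of projective dimension descends from `S` to `R`. -/
theorem exists_projective_coker_of_isTorPersistent [IsNoetherianRing R] {S : Type v} [CommRing S]
    [Algebra R S]
    (hmax : ∀ m : Ideal R, m.IsMaximal →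
      ∃ n : Ideal S, n.IsMaximal ∧ n.comap (algebraMap R S) = m)
    (hS : IsTorPersistent S) {t i₀ : ℕ} (hflat : FlatDimLT R t (ModuleCat.of R (ULift.{max u v} S)))
    (hA : ∀ i, VanishesAt A R i) (hAS : ∀ i, VanishesAt A S i)
    (h : ∀ i, i₀ ≤ i → VanishesAt A ((A 0).Coker R) i) :
    ∃ e, Module.Projective R ((A e).Coker R) := by
  let B := fun i => (A i).map (algebraMap R S)
  have hB : ∀ i, VanishesAt B S i := fun i => (hAS i).map
  let N := ModuleCat.of S ((B 0).Coker S)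
  have hN : ∀ i, i₀ + t ≤ i → VanishesAt B N i := fun i hi => by
    have h1 := FlatDimLT.vanishesAt_tensor hA h hflat
      (fun j => (hAS j).of_linearEquiv ULift.moduleEquiv) i hi
    have h2 : VanishesAt A (S ⊗[R] (A 0).Coker R) i :=
      h1.of_linearEquiv (LinearEquiv.rTensor _ ULift.moduleEquiv.symm)
    exact (h2.of_linearEquiv ((A 0).baseChangeCokerEquiv S)).map
  have hpd := hS N (inferInstanceAs (Module.Finite S ((B 0).Coker S)))
    ⟨i₀ + t + 1, fun i hi => by
      obtain ⟨i, rfl⟩ : ∃ j, i = j + 1 := ⟨i - 1, by omega⟩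
      exact (isZero_Tor_iff_vanishesAt hB (LinearMap.range ((B 0).act S)).mkQ
        (Submodule.mkQ_surjective _) (LinearMap.exact_map_mkQ_range _) N i).2
        (hN i (by omega))⟩
  obtain ⟨e, he⟩ := (projectiveDimension_coker_lt_top_iff hB 0).1 hpd
  rw [zero_add] at he
  refine ⟨e, Matrix.projective_coker (Matrix.mul_eq_zero_of_vanishesAt (hA e)) fun m hm => ?_⟩
  obtain ⟨q, -, hq⟩ := hmax m hm
  exact VanishesAt.quotient_of_comap_eq hq
    ((VanishesAt.of_projective_coker (hB e) (X := S ⧸ q)).of_map)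

end Main

theorem proposition1p2 (R : Type u) (S : Type v) [CommRing R] [CommRing S]
    [IsNoetherianRing R] [IsNoetherianRing S] [Algebra R S]
    (hflat : HasFiniteFlatDimension R S)
    (hmax : ∀ m : Ideal R, m.IsMaximal →
      ∃ n : Ideal S, n.IsMaximal ∧ n.comap (algebraMap R S) = m)
    (hS : IsTorPersistent S) : IsTorPersistent R := by
  intro M hM ⟨i₀, hTor⟩
  obtain ⟨t, ht⟩ := hflat.exists_flatDimLT
  obtain ⟨n, A, ε, hε, hex, hA⟩ := exists_matrix_resolution R M
  let e : ((A 0).Coker R) ≃ₗ[R] M :=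
    Submodule.quotEquivOfEq _ _ (LinearMap.exact_iff.1 hex).symm ≪≫ₗ
      ε.quotKerEquivOfSurjective hε
  rw [← projectiveDimension_eq_of_iso e.toModuleIso,
    projectiveDimension_coker_lt_top_iff hA]
  have hMv : ∀ i, i₀ ≤ i → VanishesAt A ((A 0).Coker R) i := fun i hi =>
    ((isZero_Tor_iff_vanishesAt hA ε hε hex M i).1 (hTor _ (by omega))).of_linearEquiv e
  have hSv := fun i hi => (ht.vanishesAt hA i hi).of_linearEquiv (ULift.moduleEquiv (R := R)).symm
  -- Dropping the first `t` matrices leaves a resolution of `coker (A t)` that is exact over `S` at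
  -- every positive position.
  obtain ⟨k, hk⟩ := exists_projective_coker_of_isTorPersistent
    (n := fun i => n (t + i)) (A := fun i => A (t + i)) (i₀ := i₀) hmax hS ht
    (fun i => (hA (t + i)).shift) (fun i => (hSv (t + i) (by omega)).shift)
    (fun i hi => (VanishesAt.coker_shift hA hMv t (t + i) (by omega)).shift)
  exact ⟨t + k, by rwa [zero_add]⟩
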